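/- Let $X$ be a real random variable whose characteristic function $f(t)=\mathbb{E}\,e^{itX}$ is symmetric (that is, $f(-t)=f(t)$ for all $t\in\mathbb{R}$) and infinitely divisible (for every positive integer $n$, $f$ is the $n$-th power of a characteristic function). For positive integers $m$ put $f_m(t)=f(\sqrt{m}\,t)^{1/m}$, the positive $m$-th root being meant ($f$ takes only positive real values). Then the limit $g(t)=\lim_{m\to\infty}f_m(t)$ exists for every $t\in\mathbb{R}$ and is the characteristic function of a probability distribution $\nu$ on $\mathbb{R}$, and the variance of $X$ (an element of $[0,\infty]$; no moment condition on $X$ is assumed) equals the variance of $\nu$ if and only if $f$ is the characteristic function of a Gaussian distribution, where the degenerate Gaussian distribution of variance $0$ is allowed. -/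

import Mathlib

open MeasureTheory ProbabilityTheory Filter Topology

/-- `f` is the characteristic function of a probability distribution on the real line. -/
def IsCharFun (f : ℝ → ℂ) : Prop :=
  ∃ μ : Measure ℝ, IsProbabilityMeasure μ ∧ ∀ t, f t = charFun μ t

/-- `f` is a symmetric characteristic function, i.e. that of a symmetric distribution. -/
def IsSymmetricCharFun (f : ℝ → ℂ) : Prop :=
  IsCharFun f ∧ ∀ t, f (-t) = f t

/-- `f` is an infinitely divisible characteristic function: for every positive integer `n` it is
the `n`-th power of a characteristic function. -/
def IsInfDivCharFun (f : ℝ → ℂ) : Prop :=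
  IsCharFun f ∧ ∀ n : ℕ, 0 < n → ∃ φ : ℝ → ℂ, IsCharFun φ ∧ ∀ t, f t = φ t ^ n

/-- `f` is the characteristic function of a Gaussian distribution with some mean and variance;
variance `0` (a point mass) is allowed. -/
def IsGaussianCharFun (f : ℝ → ℂ) : Prop :=
  ∃ (a : ℝ) (v : NNReal), ∀ t, f t = charFun (gaussianReal a v) t

/-- The function `f_m(t) = f(√m t)^(1/m)`. A symmetric infinitely divisible characteristic
function takes only positive real values, and there the complex power with exponent `1/m` is the
positive `m`-th root. -/
noncomputable def scaledRoot (f : ℝ → ℂ) (m : ℕ) (t : ℝ) : ℂ :=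
  f (Real.sqrt m * t) ^ (1 / (m : ℂ))

/-! Put ψ = -log |f|. Since 1 - cos is twice a squared sine, √(1 - cos) is subadditive. Integrating
against the laws with characteristic functions |f|^(2/n) and using n(1 - a^(1/n)) → -log a makes √ψ
subadditive (`neg_log_norm_add_le`). By Fekete's argument (`exists_tendsto_div_sq`), ψ(s)/s² tends
to its infimum c, so f_m(t) → exp(-ct²), ν is the centred Gaussian of variance 2c, and ψ(t) ≥ ct².
If X also has variance 2c, then 1 - f ≤ ct², which ψ(t) ≤ k²ψ(t/k) turns into ψ(t) ≤ ct² as k → ∞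
(`neg_log_norm_le`); hence equality. Conversely, a Gaussian f has ψ exactly quadratic. -/

/-- Two-point estimate for `1 - cos`, a weighted form of the subadditivity of `√(1 - cos)`. -/
lemma one_sub_cos_add_le (a b : ℝ) {ε : ℝ} (hε : 0 < ε) :
    1 - Real.cos (a + b) ≤ (1 + ε) * (1 - Real.cos a) + (1 + ε⁻¹) * (1 - Real.cos b) := by
  have half (x : ℝ) : 1 - Real.cos x = 2 * Real.sin (x / 2) ^ 2 := by
    rw [Real.sin_sq_eq_half_sub, mul_div_cancel₀ x two_ne_zero]; ring
  rw [half, half, half, add_div, Real.sin_add]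
  set p := Real.sin (a / 2)
  set q := Real.sin (b / 2)
  set c := Real.cos (b / 2)
  set d := Real.cos (a / 2)
  have hp : (p * c) ^ 2 ≤ p ^ 2 := by
    rw [mul_pow]; exact mul_le_of_le_one_right (sq_nonneg p) (Real.cos_sq_le_one _)
  have hq : (d * q) ^ 2 ≤ q ^ 2 := by
    rw [mul_pow]; exact mul_le_of_le_one_left (sq_nonneg q) (Real.cos_sq_le_one _)
  have key : (p * c + d * q) ^ 2 ≤ (1 + ε) * (p * c) ^ 2 + (1 + ε⁻¹) * (d * q) ^ 2 := by
    have h : (1 + ε) * (p * c) ^ 2 + (1 + ε⁻¹) * (d * q) ^ 2 - (p * c + d * q) ^ 2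
        = ε⁻¹ * (ε * (p * c) - d * q) ^ 2 := by
      field_simp
      ring
    have : 0 ≤ ε⁻¹ * (ε * (p * c) - d * q) ^ 2 := by positivity
    linarith
  have h1 := mul_le_mul_of_nonneg_left hp (by positivity : 0 ≤ 1 + ε)
  have h2 := mul_le_mul_of_nonneg_left hq (by positivity : 0 ≤ 1 + ε⁻¹)
  linarith

lemma integrable_cos_mul (μ : Measure ℝ) [IsFiniteMeasure μ] (t : ℝ) :
    Integrable (fun x => Real.cos (t * x)) μ :=
  Integrable.of_bound (by fun_prop) 1 (ae_of_all _ fun x => by simpa using Real.abs_cos_le_one _)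

lemma re_charFun_eq_integral_cos (μ : Measure ℝ) [IsFiniteMeasure μ] (t : ℝ) :
    (charFun μ t).re = ∫ x, Real.cos (t * x) ∂μ := by
  have hint : Integrable (fun x : ℝ => Complex.exp (t * x * Complex.I)) μ := by
    refine Integrable.of_bound (by fun_prop) 1 (ae_of_all _ fun x => ?_)
    rw [← Complex.ofReal_mul, Complex.norm_exp_ofReal_mul_I]
  rw [charFun_apply_real, ← RCLike.re_eq_complex_re, ← integral_re hint]
  refine integral_congr_ae (ae_of_all _ fun x => ?_)
  simp only [RCLike.re_eq_complex_re]
  rw [← Complex.ofReal_mul, Complex.exp_ofReal_mul_I_re]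

lemma one_sub_re_charFun (μ : Measure ℝ) [IsProbabilityMeasure μ] (t : ℝ) :
    1 - (charFun μ t).re = ∫ x, (1 - Real.cos (t * x)) ∂μ := by
  rw [re_charFun_eq_integral_cos, integral_sub (integrable_const _) (integrable_cos_mul μ t)]
  simp

lemma one_sub_re_charFun_add_le (μ : Measure ℝ) [IsProbabilityMeasure μ] (s t : ℝ) {ε : ℝ}
    (hε : 0 < ε) :
    1 - (charFun μ (s + t)).re ≤
      (1 + ε) * (1 - (charFun μ s).re) + (1 + ε⁻¹) * (1 - (charFun μ t).re) := by
  have hi (r : ℝ) : Integrable (fun x => 1 - Real.cos (r * x)) μ :=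
    (integrable_const _).sub (integrable_cos_mul μ r)
  simp only [one_sub_re_charFun]
  rw [← integral_const_mul, ← integral_const_mul,
    ← integral_add ((hi s).const_mul _) ((hi t).const_mul _)]
  refine integral_mono (hi _) (((hi s).const_mul _).add ((hi t).const_mul _)) fun x => ?_
  simp only [add_mul s t x]
  exact one_sub_cos_add_le _ _ hε

/-- The squared modulus of a characteristic function is a characteristic function. -/
lemma exists_charFun_eq_norm_sq (μ : Measure ℝ) [IsProbabilityMeasure μ] :
    ∃ ν : Measure ℝ, IsProbabilityMeasure ν ∧ ∀ t, charFun ν t = ((‖charFun μ t‖ ^ 2 : ℝ) : ℂ) := by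
  have : IsProbabilityMeasure (μ.map ((-1 : ℝ) * ·)) :=
    Measure.isProbabilityMeasure_map (by fun_prop)
  -- The law of the difference of two independent copies.
  refine ⟨μ ∗ μ.map ((-1 : ℝ) * ·), inferInstance, fun t => ?_⟩
  rw [charFun_conv, charFun_map_mul, neg_one_mul, charFun_neg, Complex.mul_conj,
    Complex.normSq_eq_norm_sq]

lemma tendsto_mul_one_sub_rpow_inv {a : ℝ} (ha : 0 < a) :
    Tendsto (fun n : ℕ => (n : ℝ) * (1 - a ^ (n : ℝ)⁻¹)) atTop (𝓝 (-Real.log a)) := by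
  have hd : HasDerivAt (fun y : ℝ => 1 - a ^ y) (-Real.log a) 0 := by
    simpa using ((hasDerivAt_id (0 : ℝ)).const_rpow ha).const_sub 1
  have hn : Tendsto (fun n : ℕ => (n : ℝ)⁻¹) atTop (𝓝[>] 0) :=
    tendsto_inv_atTop_nhdsGT_zero.comp tendsto_natCast_atTop_atTop
  simpa [Function.comp_def] using hd.tendsto_slope_zero_right.comp hn

/-! ### Nonvanishing of f and the exponent -log |f| -/

namespace IsInfDivCharFun

variable {f : ℝ → ℂ}

lemma continuous (hf : IsInfDivCharFun f) : Continuous f := by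
  obtain ⟨⟨μ, hμ, h⟩, -⟩ := hf
  rw [funext h]
  exact continuous_charFun

lemma apply_zero (hf : IsInfDivCharFun f) : f 0 = 1 := by
  obtain ⟨⟨μ, hμ, h⟩, -⟩ := hf
  simp [h]

lemma norm_le_one (hf : IsInfDivCharFun f) (t : ℝ) : ‖f t‖ ≤ 1 := by
  obtain ⟨⟨μ, hμ, h⟩, -⟩ := hf
  rw [h]
  exact norm_charFun_le_one t

/-- The positive roots of `|f|²` are characteristic functions. -/
lemma exists_charFun_re_eq_rpow (hf : IsInfDivCharFun f) {n : ℕ} (hn : 0 < n) :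
    ∃ μ : Measure ℝ, IsProbabilityMeasure μ ∧
      ∀ t, (charFun μ t).re = (‖f t‖ ^ 2) ^ (n : ℝ)⁻¹ := by
  obtain ⟨φ, ⟨μ, hμ, hφ⟩, hfφ⟩ := hf.2 n hn
  obtain ⟨ν, hν, h⟩ := exists_charFun_eq_norm_sq μ
  refine ⟨ν, hν, fun t => ?_⟩
  rw [h, Complex.ofReal_re, hfφ, norm_pow, pow_right_comm,
    Real.pow_rpow_inv_natCast (by positivity) hn.ne', hφ]

lemma one_sub_rpow_add_le (hf : IsInfDivCharFun f) {n : ℕ} (hn : 0 < n) (s t : ℝ) {ε : ℝ}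
    (hε : 0 < ε) :
    1 - (‖f (s + t)‖ ^ 2) ^ (n : ℝ)⁻¹ ≤ (1 + ε) * (1 - (‖f s‖ ^ 2) ^ (n : ℝ)⁻¹) +
      (1 + ε⁻¹) * (1 - (‖f t‖ ^ 2) ^ (n : ℝ)⁻¹) := by
  obtain ⟨μ, hμ, h⟩ := hf.exists_charFun_re_eq_rpow hn
  simpa only [h] using one_sub_re_charFun_add_le μ s t hε

/-- If f(2t) = 0, the estimate with s = t, ε = 1 reads 1 ≤ 4(1 - |f(t)|^(2/n)), and the right side
tends to 0. -/
lemma ne_zero_two_mul (hf : IsInfDivCharFun f) {t : ℝ} (ht : f t ≠ 0) : f (2 * t) ≠ 0 := by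
  intro h0
  have ha : 0 < ‖f t‖ ^ 2 := by positivity
  have hlim : Tendsto (fun n : ℕ => 4 * (1 - (‖f t‖ ^ 2) ^ (n : ℝ)⁻¹)) atTop (𝓝 0) := by
    have h1 : Tendsto (fun n : ℕ => (‖f t‖ ^ 2) ^ (n : ℝ)⁻¹) atTop (𝓝 1) := by
      simpa using (tendsto_const_nhds (x := ‖f t‖ ^ 2)).rpow tendsto_inv_atTop_nhds_zero_nat
        (Or.inl ha.ne')
    simpa using (h1.const_sub 1).const_mul 4
  have : (1 : ℝ) ≤ 0 := by
    refine ge_of_tendsto hlim ((eventually_gt_atTop 0).mono fun n hn => ?_)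
    have := hf.one_sub_rpow_add_le hn t t one_pos
    rw [← two_mul t, h0, norm_zero, zero_pow two_ne_zero, Real.zero_rpow (by positivity)] at this
    linarith
  linarith

lemma ne_zero (hf : IsInfDivCharFun f) (t : ℝ) : f t ≠ 0 := by
  have hlim : Tendsto (fun k : ℕ => f (t / 2 ^ k)) atTop (𝓝 (f 0)) := by
    refine (hf.continuous.tendsto 0).comp ?_
    simpa [div_eq_mul_inv] using
      (tendsto_inv_atTop_zero.comp (tendsto_pow_atTop_atTop_of_one_lt one_lt_two)).const_mul t
  obtain ⟨k, hk⟩ := (hlim.eventually_ne (by rw [hf.apply_zero]; exact one_ne_zero)).exists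
  have step (j : ℕ) : f (2 ^ j * (t / 2 ^ k)) ≠ 0 := by
    induction j with
    | zero => simpa using hk
    | succ j ih =>
      rw [pow_succ', mul_assoc]
      exact hf.ne_zero_two_mul ih
  simpa [mul_div_cancel₀] using step k

/-- A symmetric infinitely divisible characteristic function is real and positive. -/
lemma eq_ofReal_norm (hf : IsInfDivCharFun f) (hs : IsSymmetricCharFun f) (t : ℝ) :
    f t = (‖f t‖ : ℂ) := by
  have him (s : ℝ) : (f s).im = 0 := by
    obtain ⟨⟨μ, hμ, h⟩, hsymm⟩ := hs
    rw [← Complex.conj_eq_iff_im, h, ← charFun_neg, ← h, ← h, hsymm]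
  have hre (s : ℝ) : f s = ((f s).re : ℂ) := Complex.ext rfl (by simp [him])
  have hne (s : ℝ) : (f s).re ≠ 0 := fun h0 => hf.ne_zero s (by rw [hre, h0, Complex.ofReal_zero])
  have hpos : 0 < (f t).re := by
    by_contra! hneg
    have hcont : Continuous fun s => (f s).re := Complex.continuous_re.comp hf.continuous
    -- As f(0) = 1, a nonpositive value would force a zero.
    obtain ⟨s, hs0⟩ := mem_range_of_exists_le_of_exists_ge hcont ⟨t, hneg⟩
      ⟨0, by simp [hf.apply_zero]⟩
    exact hne s hs0
  rw [hre t, Complex.norm_real, Real.norm_of_nonneg hpos.le]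

/-- The exponent `-log |f|` satisfies the same two-point estimate as `1 - cos`. -/
lemma neg_log_norm_add_le (hf : IsInfDivCharFun f) (s t : ℝ) {ε : ℝ} (hε : 0 < ε) :
    -Real.log ‖f (s + t)‖ ≤
      (1 + ε) * -Real.log ‖f s‖ + (1 + ε⁻¹) * -Real.log ‖f t‖ := by
  have hlim (r : ℝ) := tendsto_mul_one_sub_rpow_inv
    (pow_pos (norm_pos_iff.2 (hf.ne_zero r)) 2)
  have := le_of_tendsto_of_tendsto (hlim (s + t))
    (((hlim s).const_mul (1 + ε)).add ((hlim t).const_mul (1 + ε⁻¹)))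
    ((eventually_gt_atTop 0).mono fun n hn => by
      have := mul_le_mul_of_nonneg_left (hf.one_sub_rpow_add_le hn s t hε) n.cast_nonneg
      simp only
      linarith)
  simp only [Real.log_pow] at this
  push_cast at this
  linarith

lemma neg_log_norm_nonneg (hf : IsInfDivCharFun f) (t : ℝ) : 0 ≤ -Real.log ‖f t‖ :=
  neg_nonneg.2 (Real.log_nonpos (norm_nonneg _) (hf.norm_le_one t))

lemma neg_log_norm_nat_mul_le (hf : IsInfDivCharFun f) (k : ℕ) (t : ℝ) :
    -Real.log ‖f (k * t)‖ ≤ (k : ℝ) ^ 2 * -Real.log ‖f t‖ := by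
  induction k with
  | zero => simp [hf.apply_zero]
  | succ k ih =>
    rcases k.eq_zero_or_pos with rfl | hk
    · simp
    have hk' : (0 : ℝ) < k := by exact_mod_cast hk
    -- The choice ε = 1/k is optimal: (1 + 1/k)k² + (1 + k) = (k + 1)².
    have h := hf.neg_log_norm_add_le (k * t) t (inv_pos.2 hk')
    have h2 := mul_le_mul_of_nonneg_left ih (by positivity : (0 : ℝ) ≤ 1 + (k : ℝ)⁻¹)
    push_cast
    rw [add_one_mul (k : ℝ) t]
    refine (h.trans (add_le_add_left h2 _)).trans_eq ?_
    field_simp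
    ring

lemma continuous_neg_log_norm (hf : IsInfDivCharFun f) :
    Continuous fun t => -Real.log ‖f t‖ :=
  (hf.continuous.norm.log fun t => (norm_pos_iff.2 (hf.ne_zero t)).ne').neg

end IsInfDivCharFun

/-! ### Quadratic Fekete lemma -/

/-- Quadratic form of Fekete's lemma: if `√ψ` is subadditive, expressed here by two-point estimates
for `ψ` itself, then `ψ s / s ^ 2` converges to its infimum as `s → ∞`. -/
lemma exists_tendsto_div_sq {ψ : ℝ → ℝ} (hc : Continuous ψ) (h0 : ∀ t, 0 ≤ ψ t)
    (hadd : ∀ s t ε : ℝ, 0 < ε → ψ (s + t) ≤ (1 + ε) * ψ s + (1 + ε⁻¹) * ψ t)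
    (hmul : ∀ (k : ℕ) (t : ℝ), ψ (k * t) ≤ (k : ℝ) ^ 2 * ψ t) :
    ∃ c : ℝ, 0 ≤ c ∧ (∀ s, 0 < s → c * s ^ 2 ≤ ψ s) ∧
      Tendsto (fun s => ψ s / s ^ 2) atTop (𝓝 c) := by
  set S : Set ℝ := (fun s => ψ s / s ^ 2) '' Set.Ioi 0
  have hS0 : ∀ x ∈ S, 0 ≤ x := by
    rintro _ ⟨s, -, rfl⟩
    have := h0 s
    positivity
  have hne : S.Nonempty := ⟨_, 1, Set.mem_Ioi.2 one_pos, rfl⟩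
  have hlow (s : ℝ) (hs : 0 < s) : sInf S ≤ ψ s / s ^ 2 := csInf_le ⟨0, hS0⟩ ⟨s, hs, rfl⟩
  refine ⟨sInf S, Real.sInf_nonneg hS0, fun s hs => (le_div_iff₀ (by positivity)).1 (hlow s hs),
    tendsto_order.2 ⟨fun b hb => ?_, fun b hb => ?_⟩⟩
  · filter_upwards [eventually_gt_atTop 0] with s hs using hb.trans_le (hlow s hs)
  obtain ⟨_, ⟨s₀, hs₀, rfl⟩, hr⟩ := exists_lt_of_csInf_lt hne hb
  have hs₀' : 0 < s₀ := hs₀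
  set r := ψ s₀ / s₀ ^ 2 with hrdef
  have hr0 : 0 ≤ r := hS0 _ ⟨s₀, hs₀, rfl⟩
  obtain ⟨ε, hε, hεb⟩ : ∃ ε : ℝ, 0 < ε ∧ (1 + ε) * r < b := by
    have hlim : Tendsto (fun ε : ℝ => (1 + ε) * r) (𝓝[>] 0) (𝓝 r) := by
      have : Continuous fun ε : ℝ => (1 + ε) * r := by fun_prop
      simpa using (this.tendsto 0).mono_left nhdsWithin_le_nhds
    obtain ⟨ε, h1, h2⟩ := ((hlim.eventually_lt_const hr).and self_mem_nhdsWithin).exists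
    exact ⟨ε, h2, h1⟩
  obtain ⟨M, hM⟩ := isCompact_Icc.exists_bound_of_continuousOn (s := Set.Icc 0 s₀) hc.continuousOn
  have hlim : Tendsto (fun s : ℝ => (1 + ε) * r + (1 + ε⁻¹) * M / s ^ 2) atTop
      (𝓝 ((1 + ε) * r)) := by
    simpa using ((tendsto_const_nhds (x := (1 + ε⁻¹) * M)).div_atTop
      (tendsto_pow_atTop two_ne_zero)).const_add ((1 + ε) * r)
  filter_upwards [hlim.eventually_lt_const hεb, eventually_gt_atTop 0] with s hsb hs
  refine lt_of_le_of_lt ?_ hsb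
  -- Write s as k·s₀ plus a remainder in [0, s₀], where ψ ≤ M.
  set k := ⌊s / s₀⌋₊
  have hk : (k : ℝ) * s₀ ≤ s := (le_div_iff₀ hs₀').1 (Nat.floor_le (by positivity))
  have hk' : s < (k + 1) * s₀ := (div_lt_iff₀ hs₀').1 (Nat.lt_floor_add_one _)
  have hrem : ψ (s - k * s₀) ≤ M :=
    (le_abs_self _).trans (hM _ ⟨by linarith, by linarith⟩)
  have hmain : ψ (k * s₀) ≤ r * s ^ 2 := calc
    ψ (k * s₀) ≤ (k : ℝ) ^ 2 * ψ s₀ := hmul k s₀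
    _ = r * (k * s₀) ^ 2 := by rw [hrdef]; field_simp
    _ ≤ r * s ^ 2 := by gcongr
  have hsum := hadd (k * s₀) (s - k * s₀) ε hε
  rw [add_sub_cancel] at hsum
  rw [div_le_iff₀ (by positivity)]
  calc ψ s ≤ (1 + ε) * (r * s ^ 2) + (1 + ε⁻¹) * M := hsum.trans (by gcongr)
    _ = ((1 + ε) * r + (1 + ε⁻¹) * M / s ^ 2) * s ^ 2 := by field_simp

/-! ### Gaussian and second-moment computations -/

lemma charFun_gaussianReal_zero (v : NNReal) (t : ℝ) :
    charFun (gaussianReal 0 v) t = (Real.exp (-(v / 2 * t ^ 2)) : ℂ) := by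
  rw [charFun_gaussianReal]
  push_cast
  congr 1
  ring

lemma norm_charFun_gaussianReal (a : ℝ) (v : NNReal) (t : ℝ) :
    ‖charFun (gaussianReal a v) t‖ = Real.exp (-(v / 2 * t ^ 2)) := by
  have h : (t * a * Complex.I - v * t ^ 2 / 2 : ℂ) =
      ((-(v / 2 * t ^ 2) : ℝ) : ℂ) + ((t * a : ℝ) : ℂ) * Complex.I := by
    push_cast; ring
  rw [charFun_gaussianReal, h, Complex.exp_add, norm_mul, Complex.norm_exp_ofReal_mul_I, mul_one,
    ← Complex.ofReal_exp, Complex.norm_real, Real.norm_of_nonneg (Real.exp_pos _).le]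

/-- The law is invariant under x ↦ -x. No moment is needed: a divergent integral is 0 by default. -/
lemma integral_id_eq_zero_of_charFun_neg {μ : Measure ℝ} [IsFiniteMeasure μ]
    (h : ∀ t, charFun μ (-t) = charFun μ t) : ∫ x, x ∂μ = 0 := by
  have hμ : μ.map ((-1 : ℝ) * ·) = μ := Measure.ext_of_charFun <| funext fun t => by
    rw [charFun_map_mul, neg_one_mul, h]
  have hint : ∫ x, x ∂μ = ∫ x, (-1 : ℝ) * x ∂μ := by
    conv_lhs => rw [← hμ]
    exact integral_map (by fun_prop) (by fun_prop)
  rw [integral_const_mul] at hint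
  linarith

lemma one_sub_re_charFun_le {μ : Measure ℝ} [IsProbabilityMeasure μ] (hμ : MemLp id 2 μ) (t : ℝ) :
    1 - (charFun μ t).re ≤ (∫ x, x ^ 2 ∂μ) / 2 * t ^ 2 := by
  have hsq : Integrable (fun x : ℝ => x ^ 2) μ := hμ.integrable_sq
  calc 1 - (charFun μ t).re = ∫ x, (1 - Real.cos (t * x)) ∂μ := one_sub_re_charFun μ t
    _ ≤ ∫ x, t ^ 2 / 2 * x ^ 2 ∂μ :=
      integral_mono ((integrable_const _).sub (integrable_cos_mul μ t)) (hsq.const_mul _)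
        fun x => by
          have := Real.one_sub_sq_div_two_le_cos (x := t * x)
          simp only
          linarith
    _ = (∫ x, x ^ 2 ∂μ) / 2 * t ^ 2 := by rw [integral_const_mul]; ring

namespace IsInfDivCharFun

variable {f : ℝ → ℂ}

lemma eq_exp_neg_log (hf : IsInfDivCharFun f) (hs : IsSymmetricCharFun f) (t : ℝ) :
    f t = (Real.exp (-(-Real.log ‖f t‖)) : ℂ) := by
  rw [neg_neg, Real.exp_log (norm_pos_iff.2 (hf.ne_zero t)),
    ← hf.eq_ofReal_norm hs]

lemma scaledRoot_eq (hf : IsInfDivCharFun f) (hs : IsSymmetricCharFun f) (m : ℕ) (t : ℝ) :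
    scaledRoot f m t = (Real.exp (-(-Real.log ‖f (Real.sqrt m * t)‖ / m)) : ℂ) := by
  set F := ‖f (Real.sqrt m * t)‖ with hF
  have hpos : 0 < F := norm_pos_iff.2 (hf.ne_zero _)
  rw [scaledRoot, hf.eq_ofReal_norm hs, ← hF]
  have h : (1 / (m : ℂ)) = ((1 / (m : ℝ) : ℝ) : ℂ) := by push_cast; rfl
  rw [h, ← Complex.ofReal_cpow hpos.le, Real.rpow_def_of_pos hpos]
  congr 2
  ring

/-- A quadratic upper bound on `1 - f` passes to the exponent `-log |f|`. -/
lemma neg_log_norm_le (hf : IsInfDivCharFun f) (hs : IsSymmetricCharFun f) {c : ℝ}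
    (hc : ∀ t, 1 - (f t).re ≤ c * t ^ 2) (t : ℝ) : -Real.log ‖f t‖ ≤ c * t ^ 2 := by
  have hre (s : ℝ) : (f s).re = ‖f s‖ := by
    conv_lhs => rw [hf.eq_ofReal_norm hs s, Complex.ofReal_re]
  -- From -log x ≤ (1 - x)/x; the denominator tends to 1 along t/k.
  have hbound (s : ℝ) : -Real.log ‖f s‖ ≤ c * s ^ 2 / ‖f s‖ := by
    have hpos : 0 < ‖f s‖ := norm_pos_iff.2 (hf.ne_zero s)
    have h1 := Real.one_sub_inv_le_log_of_pos hpos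
    have h2 := div_le_div_of_nonneg_right (hc s) hpos.le
    rw [hre, sub_div, div_self hpos.ne', one_div] at h2
    linarith
  have hlim : Tendsto (fun k : ℕ => c * t ^ 2 / ‖f (t / k)‖) atTop (𝓝 (c * t ^ 2)) := by
    have h0 : Tendsto (fun k : ℕ => ‖f (t / k)‖) atTop (𝓝 1) := by
      have := (hf.continuous.norm.tendsto 0).comp (tendsto_const_div_atTop_nhds_zero_nat t)
      simpa [Function.comp_def, hf.apply_zero] using this
    simpa [Pi.div_def] using (tendsto_const_nhds (x := c * t ^ 2)).div h0 one_ne_zero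
  refine ge_of_tendsto hlim ((eventually_gt_atTop 0).mono fun k hk => ?_)
  have hk' : (k : ℝ) ≠ 0 := by exact_mod_cast hk.ne'
  calc -Real.log ‖f t‖ = -Real.log ‖f (k * (t / k))‖ := by rw [mul_div_cancel₀ t hk']
    _ ≤ (k : ℝ) ^ 2 * -Real.log ‖f (t / k)‖ := hf.neg_log_norm_nat_mul_le k _
    _ ≤ (k : ℝ) ^ 2 * (c * (t / k) ^ 2 / ‖f (t / k)‖) := by gcongr; exact hbound _
    _ = c * t ^ 2 / ‖f (t / k)‖ := by field_simp

end IsInfDivCharFun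

/-- For a random variable `X` with symmetric infinitely divisible characteristic function `f`, the
limit `g` of the functions `f_m` exists pointwise and is the characteristic function of a
distribution `ν`; the variance of `X` (in `[0, ∞]`) equals that of `ν` if and only if `f` is a
Gaussian characteristic function. -/
theorem corollary1 {Ω : Type*} [MeasurableSpace Ω] (P : Measure Ω) [IsProbabilityMeasure P]
    (X : Ω → ℝ) (hX : AEMeasurable X P) (f : ℝ → ℂ)
    (hf : ∀ t, f t = charFun (P.map X) t)
    (hsymm : IsSymmetricCharFun f) (hdiv : IsInfDivCharFun f) :
    ∃ (g : ℝ → ℂ) (ν : Measure ℝ),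
      (∀ t, Tendsto (fun m : ℕ => scaledRoot f m t) atTop (𝓝 (g t))) ∧
      IsProbabilityMeasure ν ∧ (∀ t, g t = charFun ν t) ∧
      (evariance X P = evariance id ν ↔ IsGaussianCharFun f) := by
  have hsub := exists_tendsto_div_sq hdiv.continuous_neg_log_norm hdiv.neg_log_norm_nonneg
    (fun s t _ hε => hdiv.neg_log_norm_add_le s t hε) hdiv.neg_log_norm_nat_mul_le
  obtain ⟨c, hc0, hlow, hlim⟩ := hsub
  have hlow' (t : ℝ) : c * t ^ 2 ≤ -Real.log ‖f t‖ := by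
    rcases lt_trichotomy t 0 with ht | rfl | ht
    · simpa [hsymm.2] using hlow (-t) (neg_pos.2 ht)
    · simp [hdiv.apply_zero]
    · exact hlow t ht
  lift c to NNReal using hc0
  have hν (t : ℝ) : charFun (gaussianReal 0 (2 * c)) t = (Real.exp (-(c * t ^ 2)) : ℂ) := by
    rw [charFun_gaussianReal_zero]
    congr 4
    push_cast
    ring
  have : IsProbabilityMeasure (P.map X) := Measure.isProbabilityMeasure_map hX
  have hvar : evariance X P = evariance id (P.map X) :=
    IdentDistrib.evariance_eq ⟨hX, aemeasurable_id, by rw [Measure.map_id]⟩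
  refine ⟨_, gaussianReal 0 (2 * c), fun t => ?_, inferInstance, fun t => rfl, fun heq => ?_, ?_⟩
  · rw [hν]
    simp only [hdiv.scaledRoot_eq hsymm]
    refine (Complex.continuous_ofReal.tendsto _).comp ?_
    refine (Real.continuous_exp.tendsto _).comp (Tendsto.neg ?_)
    rcases eq_or_ne t 0 with rfl | ht
    · simp [hdiv.apply_zero]
    have habs : 0 < |t| := abs_pos.2 ht
    have hs : Tendsto (fun m : ℕ => Real.sqrt m * |t|) atTop atTop :=
      (Real.tendsto_sqrt_atTop.comp tendsto_natCast_atTop_atTop).atTop_mul_const habs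
    refine ((hlim.comp hs).mul_const (t ^ 2)).congr' ((eventually_gt_atTop 0).mono fun m hm => ?_)
    have hm' : (0 : ℝ) < m := by exact_mod_cast hm
    have hf_abs : f (Real.sqrt m * |t|) = f (Real.sqrt m * t) := by
      rcases abs_choice t with h | h
      · rw [h]
      · rw [h, mul_neg, hsymm.2]
    simp only [Function.comp_apply]
    rw [hf_abs, mul_pow, Real.sq_sqrt hm'.le, sq_abs]
    field_simp
  · have hmem_ν : MemLp id 2 (gaussianReal 0 (2 * c)) := memLp_id_gaussianReal 2
    -- Equality with a finite variance supplies the second moment of X.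
    have hmem : MemLp id 2 (P.map X) := by
      rw [← evariance_lt_top_iff_memLp aestronglyMeasurable_id, ← hvar, heq]
      exact evariance_lt_top hmem_ν
    have hmean : ∫ x, x ∂(P.map X) = 0 :=
      integral_id_eq_zero_of_charFun_neg fun t => by rw [← hf, ← hf, hsymm.2]
    have hsecond : ∫ x, x ^ 2 ∂(P.map X) = 2 * c := by
      have h1 : variance id (P.map X) = 2 * c := by
        rw [variance, ← hvar, heq, ← variance, variance_id_gaussianReal]
        push_cast
        rfl
      rw [variance_of_integral_eq_zero aemeasurable_id (by simpa using hmean)] at h1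
      simpa using h1
    refine ⟨0, 2 * c, fun t => ?_⟩
    have hup := hdiv.neg_log_norm_le hsymm (c := c) (fun s => by
      have := one_sub_re_charFun_le hmem s
      rwa [hsecond, mul_div_cancel_left₀ _ two_ne_zero, ← hf] at this) t
    rw [hν, hdiv.eq_exp_neg_log hsymm t, le_antisymm hup (hlow' t)]
  · rintro ⟨a, v, hav⟩
    have hψ (t : ℝ) : -Real.log ‖f t‖ = v / 2 * t ^ 2 := by
      rw [hav, norm_charFun_gaussianReal, Real.log_exp, neg_neg]
    have hcv : (v / 2 : ℝ) = c := by
      refine tendsto_nhds_unique (tendsto_const_nhds.congr' ?_) hlim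
      filter_upwards [eventually_gt_atTop 0] with s hs
      rw [hψ]
      field_simp
    have hμν : P.map X = gaussianReal 0 (2 * c) := Measure.ext_of_charFun <| funext fun t => by
      rw [← hf, hν, hdiv.eq_exp_neg_log hsymm t, hψ, hcv]
    rw [hvar, hμν]
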